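/- A matroid here is a finite matroid $M$ with ground set $E$ and rank function $r$; its Tutte polynomial is $T_M(x,y)=\sum_{S\subseteq E}(x-1)^{r(E)-r(S)}(y-1)^{|S|-r(S)}$. For $n\ge 1$ divisible by $3$ let $M_n=U^{(2)}_{n,2n/3}$ be the $2$-thickening of the uniform matroid of rank $2n/3$ on $n$ elements, that is, the matroid obtained from $U_{n,2n/3}$ by replacing each element with two parallel elements. The polynomial $t^3-9(t-1)$ has a largest real root $x_0$, and $x_0\approx 2.2267$ (rounded to four decimals). For every real $x$ with $0\le x<x_0$ the following hold. (a) There are infinitely many pairwise non-isomorphic matroids $M$ without loops and coloops such that $T_M(x,0)\,T_M(0,x)<T_M(1,1)^2$. (b) There is an $N$ such that for all $n\ge N$ divisible by $3$ the matroid $M_n$ has no loops and no coloops and satisfies $T_{M_n}(x,0)\,T_{M_n}(0,x)<T_{M_n}(1,1)^2$. (c) If moreover $x\ge\sqrt3$, then there is a constant $K$ such that for all $n\ge 1$ divisible by $3$ we have $T_{M_n}(x,0)\,T_{M_n}(0,x)>0$ and $$\frac{T_{M_n}(1,1)^2}{T_{M_n}(x,0)\,T_{M_n}(0,x)}=g(n)\left(\frac{9(x-1)}{x^3}\right)^n\qquad\text{with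 } n^{-K}<g(n)<n^{K}.$$ -/

import Mathlib

/-! Finite matroids: Tutte polynomial, isomorphism, uniform matroids and thickenings. -/

namespace MerinoWelsh

universe u v

/-- The rank `r(S)` of a set `S` in a matroid, as a natural number: the common cardinality of the
maximal independent subsets of `S`. -/
noncomputable def rank {α : Type u} (M : Matroid α) (S : Set α) : ℕ :=
  (M.eRk S).toNat

/-- The Tutte polynomial of a finite matroid `M` with ground set `E`, as an element of `ℤ[X₀, X₁]`:
`∑_{S ⊆ E} (X₀ - 1) ^ (r(E) - r(S)) * (X₁ - 1) ^ (|S| - r(S))`.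
Both exponents are true differences, since `r(S) ≤ r(E)` and `r(S) ≤ |S|`. -/
noncomputable def tuttePoly {α : Type u} (M : Matroid α) [M.Finite] : MvPolynomial (Fin 2) ℤ :=
  ∑ S ∈ M.ground_finite.toFinset.powerset,
    (MvPolynomial.X 0 - 1) ^ (rank M M.E - rank M (S : Set α)) *
      (MvPolynomial.X 1 - 1) ^ (S.card - rank M (S : Set α))

/-- The value `T_M(x, y)` of the Tutte polynomial at real numbers `x`, `y`. -/
noncomputable def tutte {α : Type u} (M : Matroid α) [M.Finite] (x y : ℝ) : ℝ :=
  MvPolynomial.aeval ![x, y] (tuttePoly M)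

/-- Isomorphism of matroids: a bijection of the ground sets that preserves independence in both
directions. -/
def Isomorphic {α : Type u} {β : Type v} (M : Matroid α) (N : Matroid β) : Prop :=
  ∃ e : M.E ≃ N.E, ∀ I : Set M.E,
    M.Indep (Subtype.val '' I) ↔ N.Indep (Subtype.val '' (e '' I))

/-- The uniform matroid `U_{n,r}` on the `n`-element set `Fin n`: a set is independent if and only
if it has at most `r` elements. -/
def uniform (n r : ℕ) : Matroid (Fin n) :=
  (IndepMatroid.ofFinite (E := Set.univ) Set.finite_univ (fun I => I.ncard ≤ r)
    (by simp)
    (fun I J hJ hIJ => (Set.ncard_le_ncard hIJ J.toFinite).trans hJ)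
    (fun I J _ hJ hlt => by
      obtain ⟨e, heJ, heI⟩ := Set.exists_mem_notMem_of_ncard_lt_ncard hlt I.toFinite
      refine ⟨e, heJ, heI, ?_⟩
      rw [Set.ncard_insert_of_notMem heI I.toFinite]
      omega)
    (fun I _ => Set.subset_univ I)).matroid

/-- The `k`-thickening `M^{(k)}`: each element `a` of `M` is replaced by the `k` parallel elements
`(a, 0), …, (a, k - 1)`. A set is independent if and only if it contains at most one copy of each
element and its projection is independent in `M`. -/
def thickening {α : Type u} (M : Matroid α) (k : ℕ) : Matroid (α × Fin k) :=
  M.comap Prod.fst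

/-- The matroid `M_n = U^{(2)}_{n, 2n/3}` (used for `n` divisible by `3`). -/
def witness (n : ℕ) : Matroid (Fin n × Fin 2) :=
  thickening (uniform n (2 * n / 3)) 2

end MerinoWelsh

namespace MerinoWelsh

/-! Sorting the subsets of the thickened matroid by their projection, with one or two copies of each
projected element, gives `thickSum`, a single sum over the projection size `k`
(`tutte_thickening_uniform`). With `n = 3m` and `r = 2m`, only `k = r` survives at `(1,1)`. It is
the largest term of `(2+1)^n`, so `T(1,1)` is `3^n` up to a factor `n+1`. For `x ≥ √3`, multiplying
`T(x,0)` by `(x-1)^m` and `T(0,x)` by `(x-1)^(2m)` turns the nonalternating terms into upper parts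
of the expansions of `((x-1)+1)^n` and `((x^2-1)+1)^n`. Both parts contain a largest term, and the
alternating rest takes away at most three quarters. Hence `T(x,0) T(0,x)` is `(x^3/(x-1))^n` up to a
polynomial factor (`thickSum_mul_bounds`), and `x^3/(x-1) < 9` below the root. For `x ≤ √3`, the
crude bound `8^n` suffices (`abs_thickSum_mul_le`). -/

/-! ### Alternating sums and parts of binomial expansions. -/

theorem alternating_sum_bounds (m : ℕ) : ∀ a : ℕ → ℝ, (∀ i, 0 ≤ a i) → (∀ i, a (i + 1) ≤ a i) →
    0 ≤ ∑ i ∈ Finset.range m, (-1) ^ i * a i ∧ ∑ i ∈ Finset.range m, (-1) ^ i * a i ≤ a 0 := by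
  induction m with
  | zero => intro a ha _; simpa using ha 0
  | succ m ih =>
    intro a ha hd
    have h := ih (fun i => a (i + 1)) (fun i => ha _) (fun i => hd _)
    have e : ∑ i ∈ Finset.range (m + 1), (-1) ^ i * a i =
        a 0 - ∑ i ∈ Finset.range m, (-1) ^ i * a (i + 1) := by
      rw [Finset.sum_range_succ', sub_eq_add_neg, ← Finset.sum_neg_distrib, add_comm]
      simp [pow_succ]
    rw [e]
    have := hd 0
    simp only [zero_add] at *
    constructor <;> linarith [h.1, h.2]

theorem choose_succ_real (n k : ℕ) (h : k ≤ n) :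
    (n.choose (k + 1) : ℝ) * (k + 1) = n.choose k * ((n : ℝ) - k) := by
  have := Nat.choose_succ_right_eq n k
  rw [← Nat.cast_sub h]
  exact_mod_cast this

/-- The terms of a binomial expansion increase up to index `j` when `j ≤ (n + 1 - j) t`. -/
theorem choose_mul_pow_le_of_le {n j : ℕ} {t : ℝ} (ht : 0 ≤ t) (hj : j ≤ n)
    (h : (j : ℝ) ≤ (n + 1 - j) * t) {i : ℕ} (hi : i ≤ j) :
    (n.choose i : ℝ) * t ^ i ≤ n.choose j * t ^ j := by
  induction hi using Nat.decreasingInduction with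
  | self => exact le_rfl
  | of_succ k hk ih =>
    refine le_trans ?_ ih
    have e := choose_succ_real n k (by omega)
    have hk' : (k : ℝ) + 1 ≤ j := by exact_mod_cast hk
    have h1 : (k : ℝ) + 1 ≤ ((n : ℝ) - k) * t := by nlinarith
    have h2 : (n.choose k : ℝ) ≤ n.choose (k + 1) * t := by
      have hc : (0 : ℝ) ≤ n.choose k := Nat.cast_nonneg _
      have : (n.choose k : ℝ) * (k + 1) ≤ (n.choose (k + 1) * t) * (k + 1) := by nlinarith
      exact le_of_mul_le_mul_right this (by positivity)
    calc (n.choose k : ℝ) * t ^ k ≤ n.choose (k + 1) * t * t ^ k := by gcongr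
      _ = _ := by ring

theorem sum_choose_mul_pow (n : ℕ) (t : ℝ) :
    ∑ k ∈ Finset.range (n + 1), (n.choose k : ℝ) * t ^ k = (t + 1) ^ n := by
  rw [add_pow]; exact Finset.sum_congr rfl fun k _ => by ring

/-- The upper part of a binomial expansion starting at or before the largest term. -/
theorem binomial_upper_part {j l : ℕ} {t : ℝ} (ht : 0 ≤ t)
    (h : (j : ℝ) ≤ (l + 1) * t) :
    ∑ i ∈ Finset.range (l + 1), ((j + l).choose (j + i) : ℝ) * t ^ (j + i) ≤ (t + 1) ^ (j + l) ∧
    (t + 1) ^ (j + l) ≤ (↑(j + l) + 1) *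
      ∑ i ∈ Finset.range (l + 1), ((j + l).choose (j + i) : ℝ) * t ^ (j + i) := by
  have e := sum_choose_mul_pow (j + l) t
  rw [add_assoc, Finset.sum_range_add] at e
  set A := ∑ i ∈ Finset.range j, ((j + l).choose i : ℝ) * t ^ i
  set B := ∑ i ∈ Finset.range (l + 1), ((j + l).choose (j + i) : ℝ) * t ^ (j + i) with hB
  have hA : 0 ≤ A := Finset.sum_nonneg fun i _ => by positivity
  have hjB : ((j + l).choose j : ℝ) * t ^ j ≤ B := by
    have := Finset.single_le_sum
      (f := fun i => ((j + l).choose (j + i) : ℝ) * t ^ (j + i)) (s := Finset.range (l + 1))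
      (fun i _ => by positivity) (Finset.mem_range.2 (Nat.succ_pos l))
    simpa using this
  -- Each of the `j` omitted terms is at most the first retained one.
  have hAB : A ≤ j * B := by
    have := Finset.sum_le_card_nsmul (Finset.range j)
      (fun i => ((j + l).choose i : ℝ) * t ^ i) B (fun i hi => by
        refine le_trans (choose_mul_pow_le_of_le ht (Nat.le_add_right j l) ?_
          (Finset.mem_range.1 hi).le) hjB
        push_cast; linarith)
    simpa using this
  have hB0 : 0 ≤ B := Finset.sum_nonneg fun i _ => by positivity
  rw [← e]
  push_cast
  refine ⟨by linarith, ?_⟩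
  have : 0 ≤ (l : ℝ) * B := by positivity
  linarith

/-! ### Estimates for the Tutte values as sums. -/

/-- The value at `(x, y)` of the Tutte polynomial of `U^{(2)}_{n,r}`. -/
noncomputable def thickSum (n r : ℕ) (x y : ℝ) : ℝ :=
  ∑ k ∈ Finset.range (n + 1),
    (n.choose k : ℝ) * ((x - 1) ^ (r - k) * (y - 1) ^ (k - r) * (y + 1) ^ k)

theorem thickSum_one_one {n r : ℕ} (h : r ≤ n) : thickSum n r 1 1 = n.choose r * 2 ^ r := by
  rw [thickSum, Finset.sum_eq_single r]
  · norm_num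
  · intro k _ hk
    rcases lt_or_gt_of_ne hk with hk | hk
    · simp [zero_pow (Nat.sub_ne_zero_of_lt hk)]
    · simp [zero_pow (Nat.sub_ne_zero_of_lt hk)]
  · intro hr
    exact absurd (Finset.mem_range.2 (Nat.lt_succ_of_le h)) hr

/-- The index `2m` carries the largest of the `3m + 1` terms of `(2 + 1)^(3m)`, which is at least
their average. -/
theorem thickSum_one_one_bounds (m : ℕ) :
    thickSum (3 * m) (2 * m) 1 1 ≤ 3 ^ (3 * m) ∧
    3 ^ (3 * m) ≤ (↑(3 * m) + 1) * thickSum (3 * m) (2 * m) 1 1 := by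
  rw [thickSum_one_one (by omega)]
  have e := sum_choose_mul_pow (3 * m) 2
  norm_num only at e
  have hm : ∀ k ∈ Finset.range (3 * m + 1),
      ((3 * m).choose k : ℝ) * 2 ^ k ≤ (3 * m).choose (2 * m) * 2 ^ (2 * m) := by
    intro k hk
    rcases le_total k (2 * m) with h | h
    · exact choose_mul_pow_le_of_le (by norm_num) (by omega) (by push_cast; linarith) h
    · induction k, h using Nat.le_induction with
      | base => exact le_rfl
      | succ k h ih =>
        have hk' := Finset.mem_range.1 hk
        refine le_trans ?_ (ih (Finset.mem_range.2 (by omega)))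
        have e := choose_succ_real (3 * m) k (by omega)
        have h' : (2 * m : ℝ) ≤ k := by exact_mod_cast h
        have hc : (0 : ℝ) ≤ (3 * m).choose k := Nat.cast_nonneg _
        push_cast at e
        have : ((3 * m).choose (k + 1) : ℝ) * 2 ≤ (3 * m).choose k := by
          have : ((3 * m).choose (k + 1) : ℝ) * 2 * (k + 1) ≤ (3 * m).choose k * (k + 1) := by
            nlinarith
          exact le_of_mul_le_mul_right this (by positivity)
        calc _ = ((3 * m).choose (k + 1) : ℝ) * 2 * 2 ^ k := by ring
          _ ≤ _ := by gcongr
  rw [← e]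
  constructor
  · exact Finset.single_le_sum (f := fun k => ((3 * m).choose k : ℝ) * 2 ^ k)
      (fun i _ => by positivity) (Finset.mem_range.2 (by omega))
  · have := Finset.sum_le_card_nsmul _ _ _ hm
    simpa using this

/-- The sum is `B - A`, with `B` from `k ≤ 2m` and `A` the alternating rest. The factor 4 comes from
`A ≤ 3/4 * B`, as `A` is at most its first term. -/
theorem thickSum_x_zero_bounds {m : ℕ} {x : ℝ} (hx : 1.7 ≤ x) :
    thickSum (3 * m) (2 * m) x 0 * (x - 1) ^ m ≤ x ^ (3 * m) ∧
    x ^ (3 * m) ≤ 4 * (↑(3 * m) + 1) * (thickSum (3 * m) (2 * m) x 0 * (x - 1) ^ m) := by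
  have ht : 0 < x - 1 := by linarith
  obtain ⟨a0, a1⟩ := alternating_sum_bounds m (fun i => ((3 * m).choose (2 * m + 1 + i) : ℝ))
    (fun i => Nat.cast_nonneg _) (fun i => by
      have e := Nat.choose_succ_right_eq (3 * m) (2 * m + 1 + i)
      have : (3 * m).choose (2 * m + 1 + i + 1) ≤ (3 * m).choose (2 * m + 1 + i) := by
        refine Nat.le_of_mul_le_mul_right (e.le.trans ?_) (Nat.succ_pos (2 * m + 1 + i))
        exact Nat.mul_le_mul_left _ (by omega)
      exact_mod_cast this)
  simp only [add_zero] at a1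
  have hS : thickSum (3 * m) (2 * m) x 0 =
      ∑ i ∈ Finset.range (2 * m + 1), ((3 * m).choose (m + i) : ℝ) * (x - 1) ^ i -
      ∑ i ∈ Finset.range m, (-1) ^ i * ((3 * m).choose (2 * m + 1 + i) : ℝ) := by
    rw [thickSum, show 3 * m + 1 = (2 * m + 1) + m by ring, Finset.sum_range_add,
      sub_eq_add_neg (Finset.sum _ _), ← Finset.sum_neg_distrib]
    congr 1
    -- Substituting `k = 2m - i` makes this an upper part of the expansion, starting at index `m`.
    · rw [← Finset.sum_range_reflect]
      refine Finset.sum_congr rfl fun i hi => ?_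
      have hi := Finset.mem_range.1 hi
      rw [show 2 * m - (2 * m + 1 - 1 - i) = i by omega,
        show 2 * m + 1 - 1 - i - 2 * m = 0 by omega,
        show (3 * m).choose (2 * m + 1 - 1 - i) = (3 * m).choose (m + i) from
          Nat.choose_symm_of_eq_add (by omega)]
      simp
    · refine Finset.sum_congr rfl fun i hi => ?_
      rw [show 2 * m - (2 * m + 1 + i) = 0 by omega, show 2 * m + 1 + i - 2 * m = i + 1 by omega,
        pow_succ]
      simp [mul_comm]
  obtain ⟨b0, b1⟩ := binomial_upper_part (j := m) (l := 2 * m) ht.le (by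
    push_cast; nlinarith [(Nat.cast_nonneg m : (0 : ℝ) ≤ m)])
  have hB : (∑ i ∈ Finset.range (2 * m + 1), ((3 * m).choose (m + i) : ℝ) * (x - 1) ^ i) *
      (x - 1) ^ m = ∑ i ∈ Finset.range (2 * m + 1),
        ((m + 2 * m).choose (m + i) : ℝ) * (x - 1) ^ (m + i) := by
    rw [Finset.sum_mul]
    refine Finset.sum_congr rfl fun i _ => ?_
    rw [show 3 * m = m + 2 * m by ring, pow_add]; ring
  rw [← hB, show m + 2 * m = 3 * m by ring, sub_add_cancel] at b0 b1
  have hfirst : 4 / 3 * ((3 * m).choose (2 * m + 1) : ℝ) ≤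
      ∑ i ∈ Finset.range (2 * m + 1), ((3 * m).choose (m + i) : ℝ) * (x - 1) ^ i := by
    have h1 : ((3 * m).choose (m + 0) : ℝ) * (x - 1) ^ 0 ≤ _ := Finset.single_le_sum
      (f := fun i => ((3 * m).choose (m + i) : ℝ) * (x - 1) ^ i) (s := Finset.range (2 * m + 1))
      (fun i _ => by positivity) (Finset.mem_range.2 (Nat.succ_pos _))
    refine le_trans ?_ h1
    have h2 : (3 * m).choose m = (3 * m).choose (2 * m) :=
      Nat.choose_symm_of_eq_add (by omega)
    have e := choose_succ_real (3 * m) (2 * m) (by omega)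
    have hc : (0 : ℝ) ≤ (3 * m).choose (2 * m) := Nat.cast_nonneg _
    rw [add_zero, pow_zero, mul_one, h2]
    push_cast at e
    have hm : (0 : ℝ) ≤ m := Nat.cast_nonneg m
    refine le_of_mul_le_mul_right (a := (2 * m + 1 : ℝ)) ?_ (by positivity)
    nlinarith
  rw [hS]
  set A := ∑ i ∈ Finset.range m, (-1) ^ i * ((3 * m).choose (2 * m + 1 + i) : ℝ)
  set B := ∑ i ∈ Finset.range (2 * m + 1), ((3 * m).choose (m + i) : ℝ) * (x - 1) ^ i
  have hp : 0 < (x - 1) ^ m := by positivity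
  constructor
  · refine le_trans ?_ b0
    gcongr; linarith
  · refine le_trans b1 ?_
    rw [mul_comm (4 : ℝ), mul_assoc, ← mul_assoc 4]
    gcongr
    linarith

/-- Here the terms with `k < 2m` alternate, and their sizes decrease as `k` goes down. The condition
`x^2 - 1 ≥ 2` puts a largest term of `((x^2-1)+1)^(3m)` at or above index `2m`. -/
theorem thickSum_zero_x_bounds {m : ℕ} {x : ℝ} (hx : 1.7 ≤ x) (hx' : 3 ≤ x ^ 2) :
    thickSum (3 * m) (2 * m) 0 x * (x - 1) ^ (2 * m) ≤ x ^ (2 * (3 * m)) ∧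
    x ^ (2 * (3 * m)) ≤
      4 * (↑(3 * m) + 1) * (thickSum (3 * m) (2 * m) 0 x * (x - 1) ^ (2 * m)) := by
  have ht : 0 < x - 1 := by linarith
  have hmono {i j : ℕ} (h : i ≤ j) (hj : j ≤ 2 * m) :
      ((3 * m).choose i : ℝ) * (x + 1) ^ i ≤ (3 * m).choose j * (x + 1) ^ j := by
    refine choose_mul_pow_le_of_le (by linarith) (by omega) ?_ h
    have : (j : ℝ) ≤ 2 * m := by exact_mod_cast hj
    push_cast; nlinarith
  obtain ⟨a0, a1⟩ := alternating_sum_bounds (2 * m)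
    (fun i => ((3 * m).choose (2 * m - 1 - i) : ℝ) * (x + 1) ^ (2 * m - 1 - i))
    (fun i => by positivity) (fun i => hmono (by omega) (by omega))
  simp only [Nat.sub_zero] at a1
  have hS : thickSum (3 * m) (2 * m) 0 x =
      ∑ i ∈ Finset.range (m + 1),
        ((3 * m).choose (2 * m + i) : ℝ) * ((x - 1) ^ i * (x + 1) ^ (2 * m + i)) -
      ∑ i ∈ Finset.range (2 * m), (-1) ^ i *
        (((3 * m).choose (2 * m - 1 - i) : ℝ) * (x + 1) ^ (2 * m - 1 - i)) := by
    rw [thickSum, show 3 * m + 1 = 2 * m + (m + 1) by ring, Finset.sum_range_add, add_comm,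
      sub_eq_add_neg (Finset.sum _ _), ← Finset.sum_neg_distrib]
    congr 1
    · refine Finset.sum_congr rfl fun i hi => ?_
      rw [show 2 * m - (2 * m + i) = 0 by omega, show 2 * m + i - 2 * m = i by omega]
      simp
    · rw [← Finset.sum_range_reflect]
      refine Finset.sum_congr rfl fun i hi => ?_
      have hi := Finset.mem_range.1 hi
      rw [show 2 * m - (2 * m - 1 - i) = i + 1 by omega,
        show 2 * m - 1 - i - 2 * m = 0 by omega, zero_sub, pow_succ]
      ring
  obtain ⟨b0, b1⟩ := binomial_upper_part (j := 2 * m) (l := m) (t := x ^ 2 - 1) (by linarith) (by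
    push_cast; nlinarith [(Nat.cast_nonneg m : (0 : ℝ) ≤ m)])
  have hB : (∑ i ∈ Finset.range (m + 1),
        ((3 * m).choose (2 * m + i) : ℝ) * ((x - 1) ^ i * (x + 1) ^ (2 * m + i))) *
      (x - 1) ^ (2 * m) = ∑ i ∈ Finset.range (m + 1),
        ((2 * m + m).choose (2 * m + i) : ℝ) * (x ^ 2 - 1) ^ (2 * m + i) := by
    rw [Finset.sum_mul]
    refine Finset.sum_congr rfl fun i _ => ?_
    rw [show 3 * m = 2 * m + m by ring, show x ^ 2 - 1 = (x - 1) * (x + 1) by ring, mul_pow,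
      pow_add (x - 1)]
    ring
  rw [← hB, show 2 * m + m = 3 * m by ring, sub_add_cancel, ← pow_mul] at b0 b1
  have hfirst : 4 / 3 * ∑ i ∈ Finset.range (2 * m), (-1) ^ i *
        (((3 * m).choose (2 * m - 1 - i) : ℝ) * (x + 1) ^ (2 * m - 1 - i)) ≤
      ∑ i ∈ Finset.range (m + 1),
        ((3 * m).choose (2 * m + i) : ℝ) * ((x - 1) ^ i * (x + 1) ^ (2 * m + i)) := by
    have h1 : ((3 * m).choose (2 * m + 0) : ℝ) * ((x - 1) ^ 0 * (x + 1) ^ (2 * m + 0)) ≤ _ :=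
      Finset.single_le_sum (f := fun i =>
        ((3 * m).choose (2 * m + i) : ℝ) * ((x - 1) ^ i * (x + 1) ^ (2 * m + i)))
      (s := Finset.range (m + 1)) (fun i _ => by positivity) (Finset.mem_range.2 (Nat.succ_pos _))
    refine le_trans ?_ h1
    -- For `m = 0` the index `2m - 1` truncates to 0, and `a1` bounds the empty sum only by 1, which
    -- is too weak.
    rcases Nat.eq_zero_or_pos m with rfl | hm
    · simp
    have a1' := mul_le_mul_of_nonneg_left a1 (by norm_num : (0 : ℝ) ≤ 4 / 3)
    refine a1'.trans ?_
    obtain ⟨k, hk⟩ : ∃ k, 2 * m = k + 1 := ⟨2 * m - 1, by omega⟩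
    have e := choose_succ_real (3 * m) k (by omega)
    have hk' : (2 * m : ℝ) = k + 1 := by exact_mod_cast hk
    rw [hk, Nat.add_sub_cancel]
    have hc : (0 : ℝ) ≤ (3 * m).choose (k + 1) := Nat.cast_nonneg _
    have hc' : (0 : ℝ) ≤ (3 * m).choose k := Nat.cast_nonneg _
    push_cast at e
    have h2 : ((3 * m).choose k : ℝ) ≤ 2 * (3 * m).choose (k + 1) := by
      refine le_of_mul_le_mul_right (a := (3 * m - k : ℝ)) ?_ (by linarith)
      rw [← e]
      nlinarith
    -- This uses `4/3 * 2 = 8/3 < 2.7 ≤ x + 1`.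
    have h3 : 4 / 3 * ((3 * m).choose k : ℝ) ≤ (3 * m).choose (k + 1) * (x + 1) := by nlinarith
    calc 4 / 3 * (((3 * m).choose k : ℝ) * (x + 1) ^ k)
        = (4 / 3 * ((3 * m).choose k : ℝ)) * (x + 1) ^ k := by ring
      _ ≤ (3 * m).choose (k + 1) * (x + 1) * (x + 1) ^ k := by gcongr
      _ = _ := by ring_nf
  rw [hS]
  set A := ∑ i ∈ Finset.range (2 * m), (-1) ^ i *
        (((3 * m).choose (2 * m - 1 - i) : ℝ) * (x + 1) ^ (2 * m - 1 - i))
  set B := ∑ i ∈ Finset.range (m + 1),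
        ((3 * m).choose (2 * m + i) : ℝ) * ((x - 1) ^ i * (x + 1) ^ (2 * m + i))
  have hp : 0 < (x - 1) ^ (2 * m) := by positivity
  constructor
  · refine le_trans ?_ b0
    gcongr; linarith
  · refine le_trans b1 ?_
    rw [mul_comm (4 : ℝ), mul_assoc, ← mul_assoc 4]
    gcongr
    linarith

theorem abs_thickSum_x_zero_le {m : ℕ} {x : ℝ} (hx0 : 0 ≤ x) (hx : x ≤ 2) :
    |thickSum (3 * m) (2 * m) x 0| ≤ 2 ^ (3 * m) := by
  have e := sum_choose_mul_pow (3 * m) 1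
  norm_num only at e
  rw [← e]
  refine (Finset.abs_sum_le_sum_abs _ _).trans (Finset.sum_le_sum fun k _ => ?_)
  have h1 : |x - 1| ^ (2 * m - k) ≤ 1 :=
    pow_le_one₀ (abs_nonneg _) (abs_le.2 ⟨by linarith, by linarith⟩)
  rw [abs_mul, Nat.abs_cast]
  refine mul_le_mul_of_nonneg_left ?_ (Nat.cast_nonneg _)
  simpa [abs_mul, abs_pow] using h1

/-- Termwise comparison with `(2 + 1)^(3m)`: factors `x + 1` are at most `2 * 1.4`, and beyond index
`2m` each further factor is `|x^2 - 1| ≤ 2`. -/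
theorem abs_thickSum_zero_x_le {m : ℕ} {x : ℝ} (hx0 : 0 ≤ x) (hx : x ≤ 1.8) (hx' : x ^ 2 ≤ 3) :
    |thickSum (3 * m) (2 * m) 0 x| ≤ 3 ^ (3 * m) * 1.4 ^ (2 * m) := by
  have e := sum_choose_mul_pow (3 * m) 2
  norm_num only at e
  rw [← e, Finset.sum_mul]
  refine (Finset.abs_sum_le_sum_abs _ _).trans (Finset.sum_le_sum fun k _ => ?_)
  rw [abs_mul, Nat.abs_cast, mul_assoc ((3 * m).choose k : ℝ) (2 ^ k)]
  refine mul_le_mul_of_nonneg_left ?_ (Nat.cast_nonneg _)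
  have hx1 : |x + 1| ≤ 2 * 1.4 := abs_le.2 ⟨by linarith, by linarith⟩
  have hx2 : |x - 1| * |x + 1| ≤ 2 := by
    rw [← abs_mul]; exact abs_le.2 ⟨by nlinarith, by nlinarith⟩
  rw [abs_mul, abs_mul, abs_pow, abs_pow, abs_pow]
  norm_num only [zero_sub, abs_neg, abs_one, one_pow, one_mul]
  norm_num only at hx1
  rcases le_total k (2 * m) with h | h
  · rw [Nat.sub_eq_zero_of_le h, pow_zero, one_mul]
    calc |x + 1| ^ k ≤ (14 / 5) ^ k := by gcongr
      _ = 2 ^ k * (7 / 5) ^ k := by rw [← mul_pow]; norm_num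
      _ ≤ 2 ^ k * (7 / 5) ^ (2 * m) := by gcongr; norm_num
  · obtain ⟨j, rfl⟩ := Nat.exists_eq_add_of_le h
    rw [Nat.add_sub_cancel_left]
    calc |x - 1| ^ j * |x + 1| ^ (2 * m + j)
        = (|x - 1| * |x + 1|) ^ j * |x + 1| ^ (2 * m) := by rw [pow_add, mul_pow]; ring
      _ ≤ 2 ^ j * (14 / 5) ^ (2 * m) := by gcongr
      _ = 2 ^ j * (2 * (7 / 5)) ^ (2 * m) := by norm_num
      _ = _ := by rw [mul_pow, pow_add]; ring


/-! ### Rank and Tutte polynomial of thickened uniform matroids. -/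

theorem uniform_indep_iff {n r : ℕ} {I : Set (Fin n)} : (uniform n r).Indep I ↔ I.ncard ≤ r := by
  simp [uniform]

theorem eRk_uniform (n r : ℕ) (A : Finset (Fin n)) :
    (uniform n r).eRk A = (min A.card r : ℕ) := by
  refine le_antisymm ?_ ?_
  · rw [Matroid.eRk_le_iff]
    intro I hI hr
    rw [uniform_indep_iff] at hr
    rw [← I.toFinite.cast_ncard_eq]
    have := Set.ncard_le_ncard hI A.finite_toSet
    rw [Set.ncard_coe_finset] at this
    exact_mod_cast le_min this hr
  · rw [Matroid.le_eRk_iff]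
    obtain ⟨B, hB, hc⟩ := Finset.exists_subset_card_eq (min_le_left A.card r)
    refine ⟨B, by exact_mod_cast hB, ?_, ?_⟩
    · rw [uniform_indep_iff, Set.ncard_coe_finset, hc]; exact min_le_right _ _
    · rw [Set.encard_coe_eq_coe_finsetCard, hc]

theorem rank_thickening_uniform (n r k : ℕ) (S : Finset (Fin n × Fin k)) :
    rank (thickening (uniform n r) k) S = min (S.image Prod.fst).card r := by
  rw [rank, thickening, Matroid.eRk_comap, ← Finset.coe_image, eRk_uniform]
  rfl

theorem thickening_ground (n r k : ℕ) : (thickening (uniform n r) k).E = Set.univ := by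
  simp [thickening, uniform]

theorem card_eq_sum_fibers {n : ℕ} (S : Finset (Fin n × Fin 2)) :
    S.card = ∑ a, (Finset.univ.filter fun b => (a, b) ∈ S).card := by
  rw [← Finset.card_sigma]
  refine Finset.card_bij' (fun p _ => ⟨p.1, p.2⟩) (fun p _ => (p.1, p.2)) ?_ ?_ ?_ ?_ <;> simp

/-- Summing over the sets with a given projection `A`: each element of `A` contributes one or two
copies. -/
theorem sum_filter_image_eq {n : ℕ} (A : Finset (Fin n)) (z : ℝ) :
    ∑ S ∈ (Finset.univ : Finset (Finset (Fin n × Fin 2))) with S.image Prod.fst = A,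
      z ^ (S.card - A.card) = (z + 2) ^ A.card := by
  -- `t a` lists the possible fibres over `a`, so the sum factors over `a`. An empty fibre
  -- contributes 1, since `0 - 1 = 0` in `ℕ`.
  set t : Fin n → Finset (Finset (Fin 2)) := fun a =>
    if a ∈ A then Finset.univ.filter Finset.Nonempty else {∅} with ht
  have hprod : ∏ a, ∑ B ∈ t a, z ^ (B.card - 1) = (z + 2) ^ A.card := by
    rw [← Finset.prod_const, ← Finset.prod_subset (Finset.subset_univ A)]
    · refine Finset.prod_congr rfl fun a ha => ?_
      have : (Finset.univ.filter Finset.Nonempty : Finset (Finset (Fin 2))) =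
        {{0}, {1}, {0, 1}} := by decide
      simp only [ht, if_pos ha, this]
      rw [Finset.sum_insert (by decide), Finset.sum_insert (by decide), Finset.sum_singleton]
      norm_num
      ring
    · intro a _ ha
      simp [ht, if_neg ha]
  rw [← hprod, Finset.prod_univ_sum]
  refine Finset.sum_bij' (fun S _ a => Finset.univ.filter fun b => (a, b) ∈ S)
    (fun f _ => Finset.univ.filter fun p => p.2 ∈ f p.1) ?_ ?_ ?_ ?_ ?_
  · intro S hS
    obtain rfl := (Finset.mem_filter.1 hS).2
    rw [Fintype.mem_piFinset]
    intro a
    by_cases ha : a ∈ S.image Prod.fst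
    · simp only [ht, if_pos ha]
      obtain ⟨⟨a, b⟩, hb, rfl⟩ := Finset.mem_image.1 ha
      exact Finset.mem_filter.2 ⟨Finset.mem_univ _, b, by simpa using hb⟩
    · simp only [ht, if_neg ha, Finset.mem_singleton]
      refine Finset.filter_eq_empty_iff.2 fun b _ hb => ha (Finset.mem_image.2 ⟨_, hb, rfl⟩)
  · intro f hf
    rw [Fintype.mem_piFinset] at hf
    refine Finset.mem_filter.2 ⟨Finset.mem_univ _, ?_⟩
    ext a
    have := hf a
    by_cases ha : a ∈ A
    · simp only [ht, if_pos ha, Finset.mem_filter] at this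
      obtain ⟨b, hb⟩ := this.2
      simp only [ha, iff_true, Finset.mem_image, Finset.mem_filter]
      exact ⟨(a, b), ⟨Finset.mem_univ _, hb⟩, rfl⟩
    · simp only [ht, if_neg ha, Finset.mem_singleton] at this
      simp [ha, this]
  · intro S _; ext; simp
  · intro f _; ext; simp
  · intro S hS
    obtain rfl := (Finset.mem_filter.1 hS).2
    rw [Finset.prod_pow_eq_pow_sum]
    congr 1
    rw [← Finset.sum_subset (Finset.subset_univ (S.image Prod.fst)), Finset.sum_tsub_distrib]
    · rw [card_eq_sum_fibers, Finset.card_eq_sum_ones]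
      congr 1
      symm
      refine Finset.sum_subset (Finset.subset_univ _) fun a _ ha => ?_
      exact Finset.card_eq_zero.2 (Finset.filter_eq_empty_iff.2 fun b _ hb =>
        ha (Finset.mem_image.2 ⟨_, hb, rfl⟩))
    · intro a ha
      obtain ⟨⟨a, b⟩, hb, rfl⟩ := Finset.mem_image.1 ha
      exact Finset.card_pos.2 ⟨b, by simpa using hb⟩
    · intro a _ ha
      have : (Finset.univ.filter fun b => (a, b) ∈ S) = ∅ :=
        Finset.filter_eq_empty_iff.2 fun b _ hb => ha (Finset.mem_image.2 ⟨_, hb, rfl⟩)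
      simp [this]

theorem tutte_eq_sum {α : Type*} (M : Matroid α) [M.Finite] (x y : ℝ) :
    tutte M x y = ∑ S ∈ M.ground_finite.toFinset.powerset,
      (x - 1) ^ (rank M M.E - rank M (S : Set α)) *
        (y - 1) ^ (S.card - rank M (S : Set α)) := by
  simp [tutte, tuttePoly]

theorem tutte_thickening_uniform {n r : ℕ} (hr : r ≤ n) [(thickening (uniform n r) 2).Finite]
    (x y : ℝ) : tutte (thickening (uniform n r) 2) x y = thickSum n r x y := by
  have hE : (thickening (uniform n r) 2).ground_finite.toFinset = Finset.univ := by
    ext; simp [thickening_ground]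
  have hrE : rank (thickening (uniform n r) 2) (thickening (uniform n r) 2).E = r := by
    have := rank_thickening_uniform n r 2 Finset.univ
    rw [Finset.coe_univ, ← thickening_ground n r 2] at this
    rw [this, Finset.image_univ_of_surjective Prod.fst_surjective]
    simpa using hr
  rw [tutte_eq_sum, hE, hrE, Finset.powerset_univ]
  simp only [rank_thickening_uniform]
  rw [← Finset.sum_fiberwise (s := Finset.univ)
    (g := fun S : Finset (Fin n × Fin 2) => S.image Prod.fst)]
  have key : ∀ A : Finset (Fin n),
      ∑ S ∈ (Finset.univ : Finset (Finset (Fin n × Fin 2))) with S.image Prod.fst = A,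
        (x - 1) ^ (r - min (S.image Prod.fst).card r) *
          (y - 1) ^ (S.card - min (S.image Prod.fst).card r) =
      (x - 1) ^ (r - A.card) * (y - 1) ^ (A.card - r) * (y + 1) ^ A.card := by
    intro A
    have := sum_filter_image_eq A (y - 1)
    rw [show y - 1 + 2 = y + 1 by ring] at this
    rw [← this, Finset.mul_sum]
    refine Finset.sum_congr rfl fun S hS => ?_
    obtain rfl := (Finset.mem_filter.1 hS).2
    have hle : (S.image Prod.fst).card ≤ S.card := Finset.card_image_le
    rw [mul_assoc, ← pow_add]
    congr 2 <;> omega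
  rw [Finset.sum_congr rfl fun A _ => key A, ← Finset.powerset_univ,
    Finset.sum_powerset_apply_card (fun k => (x - 1) ^ (r - k) * (y - 1) ^ (k - r) * (y + 1) ^ k)]
  simp [thickSum]

theorem thickening_uniform_not_isLoop {n r : ℕ} (hr : 1 ≤ r) (e : Fin n × Fin 2) :
    ¬ (thickening (uniform n r) 2).IsLoop e := by
  rw [thickening, Matroid.comap_isLoop_iff, ← Matroid.singleton_dep, Matroid.Dep,
    uniform_indep_iff]
  simp [hr]

/-- A coloop extends every independent set, but no element can be added to its parallel copy `(a, 1
- b)`. -/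
theorem thickening_uniform_not_isColoop {n r : ℕ} (hr : 1 ≤ r) (e : Fin n × Fin 2) :
    ¬ (thickening (uniform n r) 2).IsColoop e := by
  intro h
  obtain ⟨a, b⟩ := e
  have hI : (thickening (uniform n r) 2).Indep {(a, 1 - b)} := by
    rw [thickening, Matroid.comap_indep_iff, uniform_indep_iff]
    simp [hr]
  have := h.insert_indep_of_indep hI
  rw [thickening, Matroid.comap_indep_iff] at this
  have := this.2 (Set.mem_insert _ _) (Set.mem_insert_of_mem _ rfl) rfl
  have hb : b = 1 - b := congrArg Prod.snd this
  revert hb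
  fin_cases b <;> decide

/-! ### Relabelling, to place all the matroids on subsets of `ℕ`. -/

theorem rank_mapEmbedding {α β : Type*} (M : Matroid α) (f : α ↪ β) {S : Set α} (hS : S ⊆ M.E) :
    rank (M.mapEmbedding f) (f '' S) = rank M S := by
  rw [rank, rank, Matroid.mapEmbedding, Matroid.eRk_map _ _ hS]

theorem tutte_mapEmbedding {α β : Type*} (M : Matroid α) [M.Finite] (f : α ↪ β)
    [(M.mapEmbedding f).Finite] (x y : ℝ) : tutte (M.mapEmbedding f) x y = tutte M x y := by
  classical
  have hE : (M.mapEmbedding f).ground_finite.toFinset = M.ground_finite.toFinset.map f := by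
    ext; simp
  rw [tutte_eq_sum, tutte_eq_sum, hE, Finset.map_eq_image, Finset.powerset_image,
    Finset.sum_image (fun A _ B _ h => Finset.image_injective f.injective h)]
  refine Finset.sum_congr rfl fun S hS => ?_
  have hS' : (S : Set α) ⊆ M.E := by
    intro a ha; simpa using Finset.mem_powerset.1 hS ha
  rw [Finset.coe_image, rank_mapEmbedding M f hS', Matroid.mapEmbedding_ground_eq,
    rank_mapEmbedding M f subset_rfl, Finset.card_image_of_injective _ f.injective]

theorem mapEmbedding_isLoop_imp {α β : Type*} {M : Matroid α} {f : α ↪ β} {e : β}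
    (h : (M.mapEmbedding f).IsLoop e) : ∃ a, M.IsLoop a := by
  obtain ⟨a, _, rfl⟩ := h.mem_ground
  exact ⟨a, Matroid.mapEmbedding_isLoop_iff.1 h⟩

theorem mapEmbedding_isColoop_imp {α β : Type*} {M : Matroid α} {f : α ↪ β} {e : β}
    (h : (M.mapEmbedding f).IsColoop e) : ∃ a, M.IsColoop a := by
  rw [Matroid.IsColoop, Matroid.mapEmbedding, Matroid.map_dual] at h
  exact mapEmbedding_isLoop_imp (f := f) h

theorem Isomorphic.ncard_ground_eq {α β : Type*} {M : Matroid α} {N : Matroid β}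
    (h : Isomorphic M N) : M.E.ncard = N.E.ncard :=
  Nat.card_congr h.choose


/-! ### Comparison of growth rates. -/

/-- The common value `(x ^ 3 / (x - 1)) ^ n` controls `T(x,0) T(0,x)` up to a polynomial factor. -/
theorem thickSum_mul_bounds {m : ℕ} {x : ℝ} (hx : 1.7 ≤ x) (hx' : 3 ≤ x ^ 2) :
    thickSum (3 * m) (2 * m) x 0 * thickSum (3 * m) (2 * m) 0 x ≤ (x ^ 3 / (x - 1)) ^ (3 * m) ∧
    (x ^ 3 / (x - 1)) ^ (3 * m) ≤ 16 * (↑(3 * m) + 1) ^ 2 *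
      (thickSum (3 * m) (2 * m) x 0 * thickSum (3 * m) (2 * m) 0 x) := by
  obtain ⟨a0, a1⟩ := thickSum_x_zero_bounds (m := m) hx
  obtain ⟨b0, b1⟩ := thickSum_zero_x_bounds (m := m) hx hx'
  have ht : 0 < x - 1 := by linarith
  have hx0 : 0 < x := by linarith
  set P := thickSum (3 * m) (2 * m) x 0
  set Q := thickSum (3 * m) (2 * m) 0 x
  have e1 : P * Q * (x - 1) ^ (3 * m) = (P * (x - 1) ^ m) * (Q * (x - 1) ^ (2 * m)) := by
    rw [show 3 * m = m + 2 * m by ring, pow_add]; ring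
  have e2 : (x ^ 3) ^ (3 * m) = x ^ (3 * m) * x ^ (2 * (3 * m)) := by
    rw [← pow_mul, ← pow_add]; ring_nf
  have hQ : 0 ≤ Q * (x - 1) ^ (2 * m) := by
    have : (0 : ℝ) < 4 * (↑(3 * m) + 1) := by positivity
    exact nonneg_of_mul_nonneg_right ((by positivity : 0 ≤ x ^ (2 * (3 * m))).trans b1) this
  have hp : 0 < (x - 1) ^ (3 * m) := by positivity
  rw [div_pow, le_div_iff₀ hp, div_le_iff₀ hp, e2]
  constructor
  · rw [e1]
    exact mul_le_mul a0 b0 hQ (by positivity)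
  · refine (mul_le_mul a1 b1 (by positivity) ((by positivity : 0 ≤ x ^ (3 * m)).trans a1)).trans
      (le_of_eq ?_)
    rw [mul_assoc (16 * _), e1]
    ring

theorem abs_thickSum_mul_le {m : ℕ} {x : ℝ} (hx0 : 0 ≤ x) (hx : x ≤ 1.8) (hx' : x ^ 2 ≤ 3) :
    thickSum (3 * m) (2 * m) x 0 * thickSum (3 * m) (2 * m) 0 x ≤ 8 ^ (3 * m) := by
  refine (le_abs_self _).trans ?_
  rw [abs_mul]
  refine (mul_le_mul (abs_thickSum_x_zero_le hx0 (by linarith)) (abs_thickSum_zero_x_le hx0 hx hx')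
    (abs_nonneg _) (by positivity)).trans ?_
  rw [pow_mul, pow_mul, pow_mul, pow_mul, ← mul_pow, ← mul_pow]
  -- `2^3 * 3^3 * 1.4^2 = 423.36 < 512 = 8^3`.
  exact pow_le_pow_left₀ (by norm_num) (by norm_num) m

theorem eventually_lt_of_growth {c : ℝ} (hc : 0 ≤ c) (hc9 : c < 9) :
    ∃ N : ℕ, ∀ n, N ≤ n → ((n : ℝ) + 1) ^ 2 * c ^ n < 9 ^ n := by
  have h := tendsto_pow_const_mul_const_pow_of_abs_lt_one 2 (r := c / 9)
    (by rw [abs_of_nonneg (by positivity)]; linarith)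
  -- The 1/4 absorbs `(n + 1)^2 ≤ 4 n^2`.
  have h' := (h.eventually (gt_mem_nhds (by norm_num : (0 : ℝ) < 1 / 4)))
  obtain ⟨N, hN⟩ := Filter.eventually_atTop.1 h'
  refine ⟨N + 1, fun n hn => ?_⟩
  have h1 := hN n (by omega)
  have hn1 : (1 : ℝ) ≤ n := by exact_mod_cast (by omega : 1 ≤ n)
  rw [div_pow, ← mul_div_assoc, div_lt_iff₀ (by positivity)] at h1
  have h2 : ((n : ℝ) + 1) ^ 2 ≤ 4 * n ^ 2 := by nlinarith
  have h3 : ((n : ℝ) + 1) ^ 2 * c ^ n ≤ 4 * n ^ 2 * c ^ n := by gcongr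
  linarith

theorem witness_three_mul (m : ℕ) :
    witness (3 * m) = thickening (uniform (3 * m) (2 * m)) 2 := by
  rw [witness, show 2 * (3 * m) / 3 = 2 * m by omega]

theorem tutte_witness (m : ℕ) [(witness (3 * m)).Finite] (x y : ℝ) :
    tutte (witness (3 * m)) x y = thickSum (3 * m) (2 * m) x y := by
  have h := witness_three_mul m
  have : (thickening (uniform (3 * m) (2 * m)) 2).Finite := h ▸ inferInstance
  rw [← tutte_thickening_uniform (by omega)]
  congr!

theorem witness_not_isLoop {m : ℕ} (hm : 1 ≤ m) (e : Fin (3 * m) × Fin 2) :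
    ¬ (witness (3 * m)).IsLoop e := by
  rw [witness_three_mul]; exact thickening_uniform_not_isLoop (by omega) e

theorem witness_not_isColoop {m : ℕ} (hm : 1 ≤ m) (e : Fin (3 * m) × Fin 2) :
    ¬ (witness (3 * m)).IsColoop e := by
  rw [witness_three_mul]; exact thickening_uniform_not_isColoop (by omega) e

/-- If `T(x,0) T(0,x)` grows more slowly than `9 ^ n`, then the inequality eventually holds. -/
theorem exists_forall_thickSum_lt {c x : ℝ} (hc : 0 ≤ c) (hc9 : c < 9)
    (h : ∀ m, thickSum (3 * m) (2 * m) x 0 * thickSum (3 * m) (2 * m) 0 x ≤ c ^ (3 * m)) :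
    ∃ N : ℕ, ∀ m, N ≤ 3 * m → 1 ≤ m ∧
      thickSum (3 * m) (2 * m) x 0 * thickSum (3 * m) (2 * m) 0 x
        < thickSum (3 * m) (2 * m) 1 1 ^ 2 := by
  obtain ⟨N, hN⟩ := eventually_lt_of_growth hc hc9
  refine ⟨N + 1, fun m hm => ⟨by omega, ?_⟩⟩
  refine (h m).trans_lt ?_
  have h1 := hN (3 * m) (by omega)
  have h2 := (thickSum_one_one_bounds m).2
  have h3 : (9 : ℝ) ^ (3 * m) ≤ ((↑(3 * m) + 1) * thickSum (3 * m) (2 * m) 1 1) ^ 2 := by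
    refine le_trans (le_of_eq ?_) (pow_le_pow_left₀ (by positivity) h2 2)
    rw [pow_right_comm, show (3 : ℝ) ^ 2 = 9 by norm_num]
  rw [mul_pow] at h3
  exact lt_of_mul_lt_mul_left (h1.trans_le h3) (by positivity)

/-- An infinite family on `ℕ` obtained by relabelling the matroids `M_n`. -/
theorem exists_infinite_family {x : ℝ} {N : ℕ}
    (h : ∀ m, N ≤ 3 * m → 1 ≤ m ∧
      thickSum (3 * m) (2 * m) x 0 * thickSum (3 * m) (2 * m) 0 x
        < thickSum (3 * m) (2 * m) 1 1 ^ 2) :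
    ∃ (M : ℕ → Matroid ℕ) (_ : ∀ i, (M i).Finite),
      (∀ i j, i ≠ j → ¬ Isomorphic (M i) (M j)) ∧
      ∀ i, (∀ e, ¬ (M i).IsLoop e) ∧ (∀ e, ¬ (M i).IsColoop e) ∧
        tutte (M i) x 0 * tutte (M i) 0 x < tutte (M i) 1 1 ^ 2 := by
  let f (n : ℕ) : Fin n × Fin 2 ↪ ℕ := finProdFinEquiv.toEmbedding.trans Fin.valEmbedding
  refine ⟨fun i => (witness (3 * (N + i))).mapEmbedding (f _), fun i => inferInstance, ?_, ?_⟩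
  · intro i j hij hiso
    have hc := hiso.ncard_ground_eq
    have hg (k : ℕ) : ((witness (3 * (N + k))).mapEmbedding (f _)).E.ncard = 3 * (N + k) * 2 := by
      rw [Matroid.mapEmbedding_ground_eq, Set.ncard_image_of_injective _ (f _).injective,
        witness_three_mul, thickening_ground, Set.ncard_univ]
      simp
    rw [hg, hg] at hc
    omega
  · intro i
    obtain ⟨hm, hlt⟩ := h (N + i) (by omega)
    refine ⟨fun e he => ?_, fun e he => ?_, ?_⟩
    · obtain ⟨a, ha⟩ := mapEmbedding_isLoop_imp he
      exact witness_not_isLoop hm a ha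
    · obtain ⟨a, ha⟩ := mapEmbedding_isColoop_imp he
      exact witness_not_isColoop hm a ha
    · simpa only [tutte_mapEmbedding, tutte_witness] using hlt

/-! ### The root of the cubic and the final ratio. -/

theorem exists_isGreatest_root :
    ∃ x₀ : ℝ, IsGreatest {t : ℝ | t ^ 3 - 9 * (t - 1) = 0} x₀ ∧ 2.22666 ≤ x₀ ∧ x₀ ≤ 2.2267 := by
  have hc : ContinuousOn (fun t : ℝ => t ^ 3 - 9 * (t - 1)) (Set.Icc 2.22666 2.2267) := by fun_prop
  obtain ⟨x₀, hx, h0⟩ := intermediate_value_Icc (by norm_num) hc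
    (show (0 : ℝ) ∈ Set.Icc _ _ by constructor <;> norm_num)
  refine ⟨x₀, ⟨h0, fun t ht => ?_⟩, hx.1, hx.2⟩
  by_contra! hlt
  have ht : t ^ 3 - 9 * (t - 1) = 0 := ht
  have h0 : x₀ ^ 3 - 9 * (x₀ - 1) = 0 := h0
  have h1 := hx.1
  norm_num only at h1
  -- Subtracting the two equations leaves a quadratic factor that is positive for `t > x₀`.
  have : (t - x₀) * (t ^ 2 + t * x₀ + x₀ ^ 2 - 9) = 0 := by linear_combination ht - h0
  have h2 : 0 < t ^ 2 + t * x₀ + x₀ ^ 2 - 9 := by nlinarith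
  have := mul_pos (sub_pos.2 hlt) h2
  linarith

theorem cube_div_lt_nine {x x₀ : ℝ} (h0 : x₀ ^ 3 - 9 * (x₀ - 1) = 0) (hx₀ : 2.22666 ≤ x₀)
    (hx : 1.7 ≤ x) (hlt : x < x₀) : x ^ 3 / (x - 1) < 9 := by
  rw [div_lt_iff₀ (by linarith)]
  norm_num only at hx₀ hx
  have h2 : 0 < x ^ 2 + x * x₀ + x₀ ^ 2 - 9 := by nlinarith
  have := mul_pos (sub_pos.2 hlt) h2
  nlinarith

theorem thickSum_ratio_bounds {m : ℕ} (hm : 1 ≤ m) {x : ℝ} (hx : 1.7 ≤ x) (hx' : 3 ≤ x ^ 2) :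
    ∃ g : ℝ, ((↑(3 * m) : ℝ) ^ 7)⁻¹ < g ∧ g < (↑(3 * m) : ℝ) ^ 7 ∧
      0 < thickSum (3 * m) (2 * m) x 0 * thickSum (3 * m) (2 * m) 0 x ∧
      thickSum (3 * m) (2 * m) 1 1 ^ 2 /
        (thickSum (3 * m) (2 * m) x 0 * thickSum (3 * m) (2 * m) 0 x) =
          g * (9 * (x - 1) / x ^ 3) ^ (3 * m) := by
  obtain ⟨a0, a1⟩ := thickSum_mul_bounds (m := m) hx hx'
  obtain ⟨b0, b1⟩ := thickSum_one_one_bounds m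
  have ht : 0 < x - 1 := by linarith
  have hx0 : 0 < x := by linarith
  set P := thickSum (3 * m) (2 * m) x 0 * thickSum (3 * m) (2 * m) 0 x
  set T := thickSum (3 * m) (2 * m) 1 1
  set B := (x ^ 3 / (x - 1)) ^ (3 * m) with hB
  have hn : (3 : ℝ) ≤ ↑(3 * m) := by exact_mod_cast (by omega : 3 ≤ 3 * m)
  set n : ℝ := ↑(3 * m)
  have hB0 : 0 < B := by positivity
  have hP : 0 < P := pos_of_mul_pos_right (hB0.trans_le a1) (by positivity)
  have hT : 0 < T := pos_of_mul_pos_right ((by positivity : (0 : ℝ) < 3 ^ (3 * m)).trans_le b1)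
    (by positivity)
  have h9 : (9 : ℝ) ^ (3 * m) = (3 ^ (3 * m)) ^ 2 := by
    rw [pow_right_comm, show (3 : ℝ) ^ 2 = 9 by norm_num]
  have hq : (9 * (x - 1) / x ^ 3) ^ (3 * m) = (3 ^ (3 * m)) ^ 2 / B := by
    rw [hB, ← h9, ← div_pow]; congr 1; field_simp
  -- The exponent 7 works because `n ≥ 3`: then `(n + 1)^2 ≤ n^4` and `16 < 27 ≤ n^3`.
  have h2 : 16 * (n + 1) ^ 2 < n ^ 7 := by
    have h3 : (n + 1) ^ 2 ≤ n ^ 4 := by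
      have : n + 1 ≤ n ^ 2 := by nlinarith
      calc (n + 1) ^ 2 ≤ (n ^ 2) ^ 2 := by gcongr
        _ = n ^ 4 := by ring
    have h4 : (27 : ℝ) ≤ n ^ 3 := by
      calc (27 : ℝ) = 3 ^ 3 := by norm_num
        _ ≤ n ^ 3 := by gcongr
    have h5 : 27 * n ^ 4 ≤ n ^ 3 * n ^ 4 := by gcongr
    have h6 : 0 < n ^ 4 := by positivity
    calc 16 * (n + 1) ^ 2 ≤ 16 * n ^ 4 := by linarith
      _ < 27 * n ^ 4 := by linarith
      _ ≤ _ := h5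
      _ = n ^ 7 := by ring
  set C : ℝ := 3 ^ (3 * m)
  have hC : 0 < C := by positivity
  refine ⟨T ^ 2 * B / (P * C ^ 2), ?_, ?_, hP, ?_⟩
  · have h1 : C ^ 2 ≤ (n + 1) ^ 2 * T ^ 2 := by rw [← mul_pow]; gcongr
    rw [lt_div_iff₀ (by positivity), inv_mul_lt_iff₀ (by positivity)]
    have h3 : (n + 1) ^ 2 < n ^ 7 := by nlinarith [sq_nonneg (n + 1)]
    calc P * C ^ 2 ≤ B * ((n + 1) ^ 2 * T ^ 2) := by gcongr
      _ = (n + 1) ^ 2 * (T ^ 2 * B) := by ring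
      _ < n ^ 7 * (T ^ 2 * B) := by gcongr
  · rw [div_lt_iff₀ (by positivity)]
    calc T ^ 2 * B ≤ C ^ 2 * (16 * (n + 1) ^ 2 * P) := by gcongr
      _ = 16 * (n + 1) ^ 2 * (P * C ^ 2) := by ring
      _ < n ^ 7 * (P * C ^ 2) := by gcongr
  · rw [hq]; field_simp

end MerinoWelsh

theorem theorem2 :
    ∃ x₀ : ℝ,
      IsGreatest {t : ℝ | t ^ 3 - 9 * (t - 1) = 0} x₀ ∧
      |x₀ - 2.2267| < 0.00005 ∧
      ∀ x : ℝ, 0 ≤ x → x < x₀ →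
        -- infinitely many (pairwise non-isomorphic) finite matroids without loops and coloops
        (∃ (M : ℕ → Matroid ℕ) (_ : ∀ i, (M i).Finite),
          (∀ i j, i ≠ j → ¬ MerinoWelsh.Isomorphic (M i) (M j)) ∧
          ∀ i, (∀ e, ¬ (M i).IsLoop e) ∧ (∀ e, ¬ (M i).IsColoop e) ∧
            MerinoWelsh.tutte (M i) x 0 * MerinoWelsh.tutte (M i) 0 x
              < MerinoWelsh.tutte (M i) 1 1 ^ 2) ∧
        -- the matroids `M_n` are such for all large enough `n` divisible by `3`
        (∃ N : ℕ, ∀ n : ℕ, N ≤ n → 3 ∣ n →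
          (∀ e, ¬ (MerinoWelsh.witness n).IsLoop e) ∧
          (∀ e, ¬ (MerinoWelsh.witness n).IsColoop e) ∧
          MerinoWelsh.tutte (MerinoWelsh.witness n) x 0 *
              MerinoWelsh.tutte (MerinoWelsh.witness n) 0 x
            < MerinoWelsh.tutte (MerinoWelsh.witness n) 1 1 ^ 2) ∧
        -- exponential growth of the ratio, up to polynomial factors
        (Real.sqrt 3 ≤ x → ∃ K : ℕ, ∀ n : ℕ, 0 < n → 3 ∣ n →
          ∃ g : ℝ, ((n : ℝ) ^ K)⁻¹ < g ∧ g < (n : ℝ) ^ K ∧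
            0 < MerinoWelsh.tutte (MerinoWelsh.witness n) x 0 *
              MerinoWelsh.tutte (MerinoWelsh.witness n) 0 x ∧
            MerinoWelsh.tutte (MerinoWelsh.witness n) 1 1 ^ 2 /
                (MerinoWelsh.tutte (MerinoWelsh.witness n) x 0 *
                  MerinoWelsh.tutte (MerinoWelsh.witness n) 0 x)
              = g * (9 * (x - 1) / x ^ 3) ^ n) := by
  obtain ⟨x₀, hgr, hl, hu⟩ := MerinoWelsh.exists_isGreatest_root
  refine ⟨x₀, hgr, abs_lt.2 ⟨by norm_num at *; linarith, by norm_num at *; linarith⟩, ?_⟩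
  intro x hx0 hlt
  have hroot : x₀ ^ 3 - 9 * (x₀ - 1) = 0 := hgr.1
  have hbounds (h : Real.sqrt 3 ≤ x) : 1.7 ≤ x ∧ 3 ≤ x ^ 2 :=
    ⟨(Real.le_sqrt_of_sq_le (by norm_num)).trans h, Real.sqrt_le_left hx0 |>.1 h⟩
  obtain ⟨N, hN⟩ : ∃ N : ℕ, ∀ m, N ≤ 3 * m → 1 ≤ m ∧
      MerinoWelsh.thickSum (3 * m) (2 * m) x 0 * MerinoWelsh.thickSum (3 * m) (2 * m) 0 x
        < MerinoWelsh.thickSum (3 * m) (2 * m) 1 1 ^ 2 := by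
    rcases le_total (Real.sqrt 3) x with h | h
    · obtain ⟨h1, h2⟩ := hbounds h
      have : 0 < x - 1 := by linarith
      exact MerinoWelsh.exists_forall_thickSum_lt (by positivity)
        (MerinoWelsh.cube_div_lt_nine hroot hl h1 hlt)
        fun m => (MerinoWelsh.thickSum_mul_bounds h1 h2).1
    · exact MerinoWelsh.exists_forall_thickSum_lt (by norm_num) (by norm_num) fun m =>
        MerinoWelsh.abs_thickSum_mul_le hx0
          (h.trans ((Real.sqrt_le_left (by norm_num)).2 (by norm_num)))
          ((Real.le_sqrt hx0 (by norm_num)).1 h)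
  refine ⟨MerinoWelsh.exists_infinite_family hN, ⟨N, ?_⟩, fun h => ⟨7, ?_⟩⟩
  · rintro n hn ⟨m, rfl⟩
    obtain ⟨hm, hlt⟩ := hN m hn
    refine ⟨MerinoWelsh.witness_not_isLoop hm, MerinoWelsh.witness_not_isColoop hm, ?_⟩
    simpa only [MerinoWelsh.tutte_witness] using hlt
  · rintro n hn ⟨m, rfl⟩
    obtain ⟨h1, h2⟩ := hbounds h
    simpa only [MerinoWelsh.tutte_witness] using
      MerinoWelsh.thickSum_ratio_bounds (by omega) h1 h2
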